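/- Let $\varphi(x)=\sqrt{1-x^2}$ and let $\|\cdot\|_p$ be the norm of $L_p[-1,1]$. For $k\in\mathbb N$, $h\ge 0$ and a function $g$, let $$\Delta_h^k(g,x)=\sum_{i=0}^k\binom ki(-1)^{k-i}g\bigl(x+(i-k/2)h\bigr)\ \text{ if } x\pm kh/2\in[-1,1],\qquad \Delta_h^k(g,x)=0\ \text{ otherwise},$$ and for $\delta\ge 0$ let $\mathcal W_\delta(x)=\bigl((1-x-\delta\varphi(x)/2)(1+x-\delta\varphi(x)/2)\bigr)^{1/2}$. For $1\le p\le\infty$ put $\mathbb B_p^0=L_p[-1,1]$, and for $r\ge 1$ let $\mathbb B_p^r$ be the set of real functions $f$ whose derivative $f^{(r-1)}$ exists and is locally absolutely continuous in $(-1,1)$ and for which $\|f^{(r)}\varphi^r\|_p<\infty$. For $f\in\mathbb B_p^r$ and $t\ge0$ define $$\omega_{k,r}^\varphi(f^{(r)},t)_p=\sup_{0\le h\le t}\bigl\|\mathcal W_{kh}^r(\cdot)\,\Delta_{h\varphi(\cdot)}^k(f^{(r)},\cdot)\bigr\|_p ,$$ where the function under the norm is read as $0$ wherever the difference is $0$ by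 definition. **Theorem.** Let $k\ge 2$ and $r\ge 0$ be integers and let $1\le p\le\infty$. There is a constant $c$, depending only on $k$, $r$ and $p$, such that for all $f\in\mathbb B_p^r$ and all $t\ge 0$, $$\omega_{k,r}^\varphi(f^{(r)},t)_p\le c\,\omega_{k-1,r}^\varphi(f^{(r)},t)_p .$$ -/

import Mathlib

open MeasureTheory Set
open scoped NNReal ENNReal

noncomputable section

namespace DTModulus

/-- The step-weight `φ(x) = √(1 - x²)`. -/
def phi (x : ℝ) : ℝ := Real.sqrt (1 - x ^ 2)

/-- Lebesgue measure on `[-1, 1]`. -/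
def mu : Measure ℝ := volume.restrict (Icc (-1) 1)

open Classical in
/-- The `k`-th symmetric difference `Δ_h^k(f, x, J)`; it is `0` unless both extreme nodes
`x ± kh/2` lie in `J`. -/
def symmetricDiff (k : ℕ) (h : ℝ) (f : ℝ → ℝ) (x : ℝ) (J : Set ℝ) : ℝ :=
  if x - k * h / 2 ∈ J ∧ x + k * h / 2 ∈ J then
    ∑ i ∈ Finset.range (k + 1),
      (k.choose i : ℝ) * (-1) ^ (k - i) * f (x + ((i : ℝ) - k / 2) * h)
  else 0

/-- `g` is locally absolutely continuous in `(-1, 1)`: absolutely continuous on every compact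
subinterval. -/
def ACLoc (g : ℝ → ℝ) : Prop :=
  ∀ a b : ℝ, -1 < a → a ≤ b → b < 1 → AbsolutelyContinuousOnInterval g a b

/-- The class `B_p^r`. Functions are real functions on the line of which only the values on
`[-1, 1]` (for `r = 0`) or on `(-1, 1)` (for `r ≥ 1`) matter, up to a null set. For `r ≥ 1`:
the derivative of order `r - 1` exists in `(-1, 1)` and is locally absolutely continuous
there, and `f^{(r)} φ^r`, which is then defined almost everywhere, is in `L_p[-1, 1]`. -/
def B (p : ℝ≥0∞) : ℕ → Set (ℝ → ℝ)
  | 0 => {f | MemLp f p mu}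
  | s + 1 => {f | ContDiffOn ℝ s f (Ioo (-1) 1) ∧ ACLoc (iteratedDeriv s f) ∧
      MemLp (fun x => iteratedDeriv (s + 1) f x * phi x ^ (s + 1)) p mu}

/-- The weight `((1 - x - δφ(x)/2) (1 + x - δφ(x)/2))^{1/2}`. -/
def wt (δ x : ℝ) : ℝ :=
  Real.sqrt ((1 - x - δ * phi x / 2) * (1 + x - δ * phi x / 2))

/-- The modulus `ω_{k,r}^φ(g, t)_p` (used with `g = f^{(r)}`), as an extended nonnegative real:
the supremum over `0 ≤ h ≤ t` of the `L_p[-1, 1]` norms of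
`x ↦ wt_{kh}(x)^r Δ_{hφ(x)}^k(g, x, [-1, 1])`. -/
def modulus (k r : ℕ) (p : ℝ≥0∞) (g : ℝ → ℝ) (t : ℝ) : ℝ≥0∞ :=
  ⨆ h ∈ Icc (0 : ℝ) t,
    eLpNorm (fun x => wt (k * h) x ^ r * symmetricDiff k (h * phi x) g x (Icc (-1) 1)) p mu

end DTModulus

end

noncomputable section

namespace DTModulus

/-! The obvious recurrence writes a difference of order `n + 1` with step `h φ(x)` as two of order
`n` with the same step and shifted centres `y`. Near an endpoint this is not enough: `φ(y)` may be
smaller than `φ(x)`, and the step need not have the form `τ φ(y)` with `τ ≤ h`.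

The remedy is to shorten the steps and average. Halving the step and summing over a fan of nodes
(`fan_identity`) bounds the difference pointwise by differences of order `n` inside the original
interval, whose steps `v` are affine in a free parameter `s ∈ (0, h φ(x) / 2)` and satisfy `v ≤ h
φ(x) / 2`. For such subintervals `step_le_of_subinterval` gives `v ≤ h φ(y)`, so `v = τ φ(y)` with
`τ ≤ h`.

Integrating over `s` turns the bound into a double integral over `(x, v)`. For fixed `v` the centre
is `y = x + A h φ(x) + B v`, a map of slope at least `1 / 2`; Fubini and the substitutions `x ↦ y`,
`v = τ φ(y)` leave an average over `τ ∈ (0, h]` of integrals controlled by the lower modulus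
(`lintegral_cutoff_le`). The weight costs nothing, since it grows when the interval shrinks
(`abs_weightedDiff_le`). -/

/-! ### Difference identities with a free parameter -/

/-- A difference of step `2 * u` is controlled by differences of step `u`. -/
lemma exists_abs_fwdDiff_two_mul_le (k : ℕ) (u : ℝ) (f : ℝ → ℝ) (a : ℝ) :
    ∃ l ≤ k, |(fwdDiff (2 * u))^[k] f a| ≤ 2 ^ k * |(fwdDiff u)^[k] f (a + l * u)| := by
  induction k generalizing f with
  | zero => exact ⟨0, le_rfl, by simp⟩
  | succ k ih =>
    -- With `E` the shift by `u`, this is `E² - 1 = (E - 1)(E + 1)`.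
    have hsplit : fwdDiff (2 * u) f = fwdDiff u ((fun x => f (x + u)) + f) := by
      funext x
      simp only [fwdDiff, Pi.add_apply]
      rw [show x + u + u = x + 2 * u by ring]
      ring
    obtain ⟨l, hl, h⟩ := ih (fwdDiff (2 * u) f)
    have key : (fwdDiff u)^[k] (fwdDiff (2 * u) f) (a + l * u) =
        (fwdDiff u)^[k + 1] f (a + (l + 1 : ℕ) * u) + (fwdDiff u)^[k + 1] f (a + l * u) := by
      rw [hsplit, ← Function.iterate_succ_apply, fwdDiff_iter_add, Pi.add_apply,
        fwdDiff_iter_comp_add]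
      rw [show a + (l + 1 : ℕ) * u = a + l * u + u by push_cast; ring]
    rw [key] at h
    rw [Function.iterate_succ_apply]
    set x := (fwdDiff u)^[k + 1] f (a + (l + 1 : ℕ) * u)
    set y := (fwdDiff u)^[k + 1] f (a + l * u)
    have hxy := abs_add_le x y
    have h2 : (0 : ℝ) < 2 ^ k := by positivity
    rcases le_total |x| |y| with hc | hc
    · refine ⟨l, by omega, h.trans ?_⟩
      change _ ≤ 2 ^ (k + 1) * |y|
      rw [pow_succ, mul_assoc]
      exact mul_le_mul_of_nonneg_left (by linarith) h2.le
    · refine ⟨l + 1, by omega, h.trans ?_⟩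
      change _ ≤ 2 ^ (k + 1) * |x|
      rw [pow_succ, mul_assoc]
      exact mul_le_mul_of_nonneg_left (by linarith) h2.le

lemma fwdDiff_iter_eq_sum (u : ℝ) (f : ℝ → ℝ) (n : ℕ) (a : ℝ) :
    (fwdDiff u)^[n] f a =
      ∑ i ∈ Finset.range (n + 1), (-1) ^ (n - i) * (n.choose i : ℝ) * f (a + i * u) := by
  rw [fwdDiff_iter_eq_sum_shift]
  refine Finset.sum_congr rfl fun i _ => ?_
  simp [zsmul_eq_mul]

/-- Summing over a fan of nodes `a + i u + j s (1 - i / k)` in two orders. -/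
lemma fan_identity (k n : ℕ) (u s : ℝ) (f : ℝ → ℝ) (a : ℝ) :
    ∑ j ∈ Finset.range (n + 1), (-1) ^ (n - j) * (n.choose j : ℝ) *
        (fwdDiff (u - j * s / k))^[k] f (a + j * s) =
      ∑ i ∈ Finset.range (k + 1), (-1) ^ (k - i) * (k.choose i : ℝ) *
        (fwdDiff (s * (1 - i / k)))^[n] f (a + i * u) := by
  simp only [fwdDiff_iter_eq_sum, Finset.mul_sum]
  rw [Finset.sum_comm]
  refine Finset.sum_congr rfl fun i _ => Finset.sum_congr rfl fun j _ => ?_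
  rw [show a + j * s + i * (u - j * s / k) = a + i * u + j * (s * (1 - i / k)) by ring]
  ring

/-- In the fan identity the term `j = 0` is the difference to be estimated. If every other term were
small, the identity would fail, because the remaining binomial coefficients add up to less than `2 ^
(n + 2)`. -/
lemma exists_abs_fwdDiff_fan_le (n : ℕ) (hn : 1 ≤ n) (u s : ℝ) (f : ℝ → ℝ) (a : ℝ) :
    (∃ j, 1 ≤ j ∧ j ≤ n ∧ |(fwdDiff u)^[n + 1] f a| ≤
      2 ^ (n + 2) * |(fwdDiff (u - j * s / (n + 1 : ℕ)))^[n + 1] f (a + j * s)|) ∨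
    (∃ i ≤ n, |(fwdDiff u)^[n + 1] f a| ≤
      2 ^ (n + 2) * |(fwdDiff (s * (1 - i / (n + 1 : ℕ))))^[n] f (a + i * u)|) := by
  by_contra! hcon
  obtain ⟨h1, h2⟩ := hcon
  have hfan := fan_identity (n + 1) n u s f a
  rw [Finset.sum_range_succ', Finset.sum_range_succ _ (n + 1)] at hfan
  have hk : ((n + 1 : ℕ) : ℝ) ≠ 0 := by positivity
  -- At `i = n + 1` the fan closes: all its nodes coincide, and a difference of positive order with
  -- step zero vanishes.
  have hz : (fwdDiff (s * (1 - ((n + 1 : ℕ) : ℝ) / (n + 1 : ℕ))))^[n] f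
      (a + (n + 1 : ℕ) * u) = 0 := by
    rw [div_self hk, sub_self, mul_zero]
    obtain ⟨m, rfl⟩ : ∃ m, n = m + 1 := ⟨n - 1, by omega⟩
    rw [Function.iterate_succ_apply']
    simp [fwdDiff]
  rw [hz] at hfan
  simp only [Nat.choose_zero_right, Nat.cast_zero, zero_mul, zero_div, sub_zero, add_zero,
    Nat.sub_zero,    mul_zero, Nat.cast_one, mul_one] at hfan
  set T := (fwdDiff u)^[n + 1] f a
  have hT : 0 < |T| := by
    have := h2 0 (Nat.zero_le _)
    exact lt_of_le_of_lt (by positivity) this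
  have habs : ∀ (m i : ℕ) (z : ℝ), |(-1) ^ m * (i : ℝ) * z| = i * |z| := by
    intro m i z
    rw [abs_mul, abs_mul, abs_pow, abs_neg, abs_one, one_pow, one_mul, Nat.abs_cast]
  have hTle : |T| ≤ (∑ j ∈ Finset.range n, (n.choose (j + 1) : ℝ) *
        |(fwdDiff (u - (j + 1 : ℕ) * s / (n + 1 : ℕ)))^[n + 1] f (a + (j + 1 : ℕ) * s)|) +
      ∑ i ∈ Finset.range (n + 1), ((n + 1).choose i : ℝ) *
        |(fwdDiff (s * (1 - i / (n + 1 : ℕ))))^[n] f (a + i * u)| := by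
    have e : |T| = |(-1) ^ n * T| := by simp [abs_mul]
    rw [e, eq_sub_of_add_eq' hfan, sub_eq_add_neg]
    refine (abs_add_le _ _).trans ?_
    rw [abs_neg, add_comm]
    refine add_le_add ?_ ?_
    · refine (Finset.abs_sum_le_sum_abs _ _).trans_eq (Finset.sum_congr rfl fun j _ => habs _ _ _)
    · refine (Finset.abs_sum_le_sum_abs _ _).trans_eq (Finset.sum_congr rfl fun j _ => habs _ _ _)
  have hN : (0 : ℝ) < 2 ^ (n + 2) := by positivity
  have hb : 2 ^ (n + 2) * |T| ≤ (∑ j ∈ Finset.range n, (n.choose (j + 1) : ℝ) * |T|) +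
      ∑ i ∈ Finset.range (n + 1), ((n + 1).choose i : ℝ) * |T| := by
    refine (mul_le_mul_of_nonneg_left hTle hN.le).trans ?_
    rw [mul_add, Finset.mul_sum, Finset.mul_sum]
    refine add_le_add (Finset.sum_le_sum fun j hj => ?_) (Finset.sum_le_sum fun i hi => ?_)
    · rw [mul_left_comm]
      exact mul_le_mul_of_nonneg_left
        (h1 (j + 1) (by omega) (by have := Finset.mem_range.1 hj; omega)).le (by positivity)
    · rw [mul_left_comm]
      exact mul_le_mul_of_nonneg_left
        (h2 i (by have := Finset.mem_range.1 hi; omega)).le (by positivity)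
  rw [← Finset.sum_mul, ← Finset.sum_mul, ← add_mul] at hb
  have hb' := le_of_mul_le_mul_right hb hT
  -- The two coefficient sums total `(2^n - 1) + (2^(n+1) - 1) = 3 * 2^n - 2 < 2^(n+2)`.
  have s1 : ∑ j ∈ Finset.range n, (n.choose (j + 1) : ℝ) + 1 = 2 ^ n := by
    have := Nat.sum_range_choose n
    rw [Finset.sum_range_succ'] at this
    simp only [Nat.choose_zero_right] at this
    exact_mod_cast this
  have s2 : ∑ i ∈ Finset.range (n + 1), ((n + 1).choose i : ℝ) + 1 = 2 ^ (n + 1) := by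
    have := Nat.sum_range_choose (n + 1)
    rw [Finset.sum_range_succ] at this
    simp only [Nat.choose_self] at this
    exact_mod_cast this
  have s3 : (0 : ℝ) < 2 ^ n := by positivity
  rw [pow_succ, pow_succ] at hb'
  rw [pow_succ] at s2
  linarith

/-- A difference of order `n + 1` is controlled by a difference of order `n` taken in its convex
hull with a step depending on a free parameter `s`. -/
lemma exists_abs_fwdDiff_succ_le (n : ℕ) (hn : 1 ≤ n) (u s : ℝ) (f : ℝ → ℝ) (a : ℝ) :
    ∃ l ≤ n + 1,
      (∃ j, 1 ≤ j ∧ j ≤ n ∧ ∃ e ≤ 1, |(fwdDiff (2 * u))^[n + 1] f a| ≤ 4 ^ (n + 2) *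
        |(fwdDiff (u - j * s / (n + 1 : ℕ)))^[n] f
          (a + l * u + j * s + (e : ℕ) * (u - j * s / (n + 1 : ℕ)))|) ∨
      (∃ i ≤ n, |(fwdDiff (2 * u))^[n + 1] f a| ≤ 4 ^ (n + 2) *
        |(fwdDiff (s * (1 - i / (n + 1 : ℕ))))^[n] f (a + l * u + i * u)|) := by
  obtain ⟨l, hl, h⟩ := exists_abs_fwdDiff_two_mul_le (n + 1) u f a
  have h4 : (4 : ℝ) ^ (n + 2) = 2 ^ (n + 1) * (2 ^ (n + 2) * 2) := by
    rw [show (4 : ℝ) = 2 * 2 by norm_num, mul_pow]; ring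
  have hp : (0 : ℝ) < 2 ^ (n + 1) := by positivity
  have hq : (0 : ℝ) < 2 ^ (n + 2) := by positivity
  refine ⟨l, hl, ?_⟩
  rcases exists_abs_fwdDiff_fan_le n hn u s f (a + l * u) with ⟨j, hj1, hjn, hj⟩ | ⟨i, hi, hi'⟩
  · left
    refine ⟨j, hj1, hjn, ?_⟩
    set v := u - j * s / (n + 1 : ℕ)
    -- The recurrence lowers the order by one; `e` will select the larger of the two terms, at the
    -- cost of a factor 2.
    have hv : (fwdDiff v)^[n + 1] f (a + l * u + j * s) =
        (fwdDiff v)^[n] f (a + l * u + j * s + (1 : ℕ) * v) -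
          (fwdDiff v)^[n] f (a + l * u + j * s + (0 : ℕ) * v) := by
      rw [Function.iterate_succ_apply']
      simp [fwdDiff]
    rw [hv] at hj
    set x := (fwdDiff v)^[n] f (a + l * u + j * s + (1 : ℕ) * v) with hx
    set y := (fwdDiff v)^[n] f (a + l * u + j * s + (0 : ℕ) * v) with hy
    have hxy := abs_sub x y
    have hfin : ∀ z, |x - y| ≤ 2 * |z| →
        |(fwdDiff (2 * u))^[n + 1] f a| ≤ 4 ^ (n + 2) * |z| := by
      intro z hz
      rw [h4]
      calc _ ≤ _ := h
        _ ≤ 2 ^ (n + 1) * (2 ^ (n + 2) * (2 * |z|)) := by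
            refine mul_le_mul_of_nonneg_left (hj.trans ?_) hp.le
            exact mul_le_mul_of_nonneg_left hz hq.le
        _ = _ := by ring
    rcases le_total |x| |y| with hc | hc
    · exact ⟨0, by omega, hfin y (by linarith)⟩
    · exact ⟨1, by omega, hfin x (by linarith)⟩
  · right
    refine ⟨i, hi, ?_⟩
    rw [h4]
    calc _ ≤ _ := h
      _ ≤ _ := mul_le_mul_of_nonneg_left hi' hp.le
      _ ≤ _ := by
        set z := |(fwdDiff (s * (1 - i / (n + 1 : ℕ))))^[n] f (a + l * u + i * u)|
        have hz : 0 ≤ z := abs_nonneg _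
        rw [mul_assoc, mul_assoc]
        refine mul_le_mul_of_nonneg_left (mul_le_mul_of_nonneg_left ?_ hq.le) hp.le
        linarith

/-! ### Admissible centres and the geometry of subintervals -/

/-- The interior points `x` for which the nodes `x ± k h φ(x) / 2` lie in `[-1, 1]`. -/
def dom (k : ℕ) (h : ℝ) : Set ℝ := {x | |x| < 1 ∧ (k * h) ^ 2 * (1 + |x|) ≤ 4 * (1 - |x|)}

lemma measurableSet_dom (k : ℕ) (h : ℝ) : MeasurableSet (dom k h) := by
  have h1 : Measurable fun x : ℝ => |x| := continuous_abs.measurable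
  exact (measurableSet_lt h1 measurable_const).inter
    (measurableSet_le ((h1.const_add 1).const_mul _) ((h1.const_sub 1).const_mul _))

lemma convex_dom (k : ℕ) (h : ℝ) : Convex ℝ (dom k h) := by
  rw [convex_iff_ordConnected]
  refine ⟨fun x hx y hy z hz => ?_⟩
  have key : ∀ w ∈ dom k h, |z| ≤ |w| → z ∈ dom k h := by
    rintro w ⟨hw1, hw2⟩ hzw
    refine ⟨hzw.trans_lt hw1, ?_⟩
    nlinarith [sq_nonneg (k * h), mul_le_mul_of_nonneg_left hzw (sq_nonneg (k * h))]
  rcases le_total |x| |y| with hc | hc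
  · refine key y hy (abs_le.2 ⟨?_, hz.2.trans (le_abs_self y)⟩)
    linarith [neg_abs_le x, hz.1]
  · refine key x hx (abs_le.2 ⟨?_, ?_⟩)
    · linarith [neg_abs_le x, hz.1]
    · linarith [le_abs_self y, hz.2]

lemma phi_nonneg (x : ℝ) : 0 ≤ phi x := Real.sqrt_nonneg _

lemma measurable_phi : Measurable phi := by
  unfold phi; fun_prop

lemma phi_sq {x : ℝ} (hx : |x| ≤ 1) : phi x ^ 2 = (1 - |x|) * (1 + |x|) := by
  have : 0 ≤ 1 - x ^ 2 := by nlinarith [sq_abs x, abs_nonneg x]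
  rw [phi, Real.sq_sqrt this, ← sq_abs x]; ring

lemma phi_sq' {x : ℝ} (hx : |x| ≤ 1) : phi x ^ 2 = (1 - x) * (1 + x) := by
  rw [phi_sq hx]; nlinarith [sq_abs x]

lemma phi_pos {x : ℝ} (hx : |x| < 1) : 0 < phi x := by
  refine Real.sqrt_pos.2 ?_
  nlinarith [sq_abs x, abs_nonneg x]

/-- Both sides are nonnegative, so square; `φ(x)² = (1 - |x|)(1 + |x|)` then lets a factor `1 - |x|`
cancel. -/
lemma dom_iff {k : ℕ} {h x : ℝ} (hh : 0 ≤ h) (hx : |x| < 1) :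
    x ∈ dom k h ↔ k * (h * phi x) / 2 ≤ 1 - |x| := by
  have h1 : 0 ≤ k * (h * phi x) / 2 := by have := phi_nonneg x; positivity
  have h2 : 0 < 1 - |x| := by linarith
  have h3 := phi_sq hx.le
  have e : (k * (h * phi x) / 2) ^ 2 = (k * h) ^ 2 * (1 + |x|) / 4 * (1 - |x|) := by
    rw [show (k * (h * phi x) / 2) ^ 2 = (k * h) ^ 2 * phi x ^ 2 / 4 by ring, h3]; ring
  rw [← abs_of_nonneg h1, ← abs_of_nonneg h2.le, ← sq_le_sq, e]
  simp only [dom, mem_ofPred_eq, hx, true_and]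
  rw [pow_two (1 - |x|), mul_le_mul_iff_left₀ h2]
  constructor <;> intro H <;> linarith

lemma dom_iff_nodes {k : ℕ} {h x : ℝ} (hh : 0 ≤ h) (hx : |x| < 1) :
    x ∈ dom k h ↔ x - k * (h * phi x) / 2 ∈ Icc (-1 : ℝ) 1 ∧
      x + k * (h * phi x) / 2 ∈ Icc (-1 : ℝ) 1 := by
  have h1 : 0 ≤ k * (h * phi x) / 2 := by have := phi_nonneg x; positivity
  rw [dom_iff hh hx]
  constructor
  · intro H
    have a1 := le_abs_self x
    have a2 := neg_abs_le x
    refine ⟨⟨?_, ?_⟩, ?_, ?_⟩ <;> linarith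
  · rintro ⟨⟨h2, h3⟩, h4, h5⟩
    rcases abs_cases x with ⟨e, _⟩ | ⟨e, _⟩ <;> rw [e] <;> linarith

lemma hasDerivAt_phi {x : ℝ} (hx : |x| < 1) : HasDerivAt phi (-x / phi x) x := by
  have h0 : 1 - x ^ 2 ≠ 0 := by nlinarith [sq_abs x, abs_nonneg x]
  have h1 : HasDerivAt (fun y : ℝ => 1 - y ^ 2) (-(2 * x)) x := by
    simpa using (hasDerivAt_pow 2 x).const_sub 1
  have h2 := h1.sqrt h0
  rw [← mul_neg, mul_div_mul_left _ _ two_ne_zero] at h2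
  exact h2

/-- The shift by a multiple of the step has derivative at least `1 / 2`. -/
lemma half_le_deriv_shift {k : ℕ} {h x A : ℝ} (hh : 0 ≤ h) (hx : x ∈ dom k h)
    (hA : |A| ≤ k / 2) : 1 / 2 ≤ 1 + A * (h * (-x / phi x)) := by
  have hp := phi_pos hx.1
  have hd := (dom_iff hh hx.1).1 hx
  have h3 := phi_sq hx.1.le
  -- Admissibility bounds the left side by `|x| / (1 + |x|)`, which is at most `1 / 2`.
  have key : |A * (h * (-x / phi x))| ≤ 1 / 2 := by
    rw [abs_mul, abs_mul, abs_div, abs_neg, abs_of_nonneg hh, abs_of_pos hp]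
    have : |A| * (h * (|x| / phi x)) ≤ k / 2 * (h * (|x| / phi x)) :=
      mul_le_mul_of_nonneg_right hA (by positivity)
    refine this.trans ?_
    rw [show (k : ℝ) / 2 * (h * (|x| / phi x)) = (k * (h * phi x) / 2) * |x| / phi x ^ 2 by
      field_simp, div_le_iff₀ (by positivity), h3]
    have := abs_nonneg x
    have h4 : 0 < 1 - |x| := by linarith [hx.1]
    nlinarith [mul_le_mul_of_nonneg_right hd this]
  linarith [neg_abs_le (A * (h * (-x / phi x)))]

/-- `X` and `Y` are the distances of the old and new centres from an endpoint. Since `v ≤ δ`, the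
worst case is `X = (N + 1) δ / 2`, where the claim becomes `(N + 1) v ≤ N δ`. This is why steps were
halved: for `N = 1` it says exactly `v ≤ δ / 2`. -/
lemma sq_mul_le_of_sub_le {N δ v X Y : ℝ} (hN : 1 ≤ N) (hv : 0 < v) (hvδ : v ≤ δ / 2)
    (hX : (N + 1) * δ / 2 ≤ X) (hY : X - (N + 1) * δ / 2 + N * v / 2 ≤ Y) :
    v ^ 2 * X ≤ δ ^ 2 * Y := by
  have hδ : 0 < δ := by linarith
  have c1 : δ ^ 2 * (X - (N + 1) * δ / 2 + N * v / 2) ≤ δ ^ 2 * Y :=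
    mul_le_mul_of_nonneg_left hY (sq_nonneg _)
  have hvd : v ^ 2 ≤ δ ^ 2 := pow_le_pow_left₀ hv.le (by linarith) 2
  have c2 : 0 ≤ (δ ^ 2 - v ^ 2) * (X - (N + 1) * δ / 2) :=
    mul_nonneg (by linarith) (by linarith)
  have c4 : 0 ≤ (δ / 2 - v) * (v * (N + 1) * δ) :=
    mul_nonneg (by linarith) (by positivity)
  have c5 : 0 ≤ δ ^ 2 * v * (N - 1) := mul_nonneg (by positivity) (by linarith)
  linarith

/-- Geometry of a subinterval with centre `y` and `n` steps `v`. -/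
lemma step_le_of_subinterval {n : ℕ} {h x y v : ℝ} (hn : 1 ≤ n) (hh : 0 < h)
    (hx : x ∈ dom (n + 1) h) (hv : 0 < v) (hv2 : v ≤ h * phi x / 2)
    (hy : |y - x| + n * v / 2 ≤ (n + 1 : ℕ) * (h * phi x) / 2) :
    |y| < 1 ∧ v ≤ h * phi y ∧ phi y ≤ 2 * phi x := by
  have hp := phi_pos hx.1
  have hd := (dom_iff hh.le hx.1).1 hx
  have hn' : (1 : ℝ) ≤ n := by exact_mod_cast hn
  push_cast at hd hy
  have hδ : 0 < h * phi x := by positivity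
  have hx1 := abs_lt.1 hx.1
  have hnv : 0 < n * v := by positivity
  have a1 := le_abs_self x
  have a2 := neg_abs_le x
  have b1 := le_abs_self (y - x)
  have b2 := neg_abs_le (y - x)
  have hy1 : |y| < 1 := abs_lt.2 ⟨by linarith, by linarith⟩
  have hy1' := abs_lt.1 hy1
  have e1 := phi_sq' hx.1.le
  have e2 := phi_sq' hy1.le
  have hpy := phi_pos hy1
  have hd1 : (n + 1) * (h * phi x) / 2 ≤ 1 - x := by linarith
  have hd2 : (n + 1) * (h * phi x) / 2 ≤ 1 + x := by linarith
  have key : v ^ 2 * phi x ^ 2 ≤ (h * phi x) ^ 2 * phi y ^ 2 := by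
    rw [e1, e2]
    have aux : ∀ X X' Y Y' : ℝ, 0 < X' → (n + 1) * (h * phi x) / 2 ≤ X →
        X - (n + 1) * (h * phi x) / 2 + n * v / 2 ≤ Y → X' ≤ Y' →
        v ^ 2 * (X * X') ≤ (h * phi x) ^ 2 * (Y * Y') := by
      intro X X' Y Y' hX' h1 h2 h3
      have hs := sq_mul_le_of_sub_le hn' hv hv2 h1 h2
      have hY : 0 ≤ Y := by linarith
      calc v ^ 2 * (X * X') = v ^ 2 * X * X' := by ring
        _ ≤ (h * phi x) ^ 2 * Y * X' := mul_le_mul_of_nonneg_right hs hX'.le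
        _ ≤ (h * phi x) ^ 2 * Y * Y' := mul_le_mul_of_nonneg_left h3 (by positivity)
        _ = _ := by ring
    -- Moving towards one endpoint decreases only the corresponding factor of `φ² = (1 - y)(1 + y)`;
    -- the other factor does not decrease.
    rcases le_total x y with hxy | hxy
    · rw [abs_of_nonneg (by linarith)] at hy
      exact aux _ _ _ _ (by linarith) hd1 (by linarith) (by linarith)
    · rw [abs_of_nonpos (by linarith)] at hy
      rw [mul_comm (1 - x), mul_comm (1 - y)]
      exact aux _ _ _ _ (by linarith) hd2 (by linarith) (by linarith)
  refine ⟨hy1, ?_, ?_⟩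
  · have : (v * phi x) ^ 2 ≤ (h * phi y * phi x) ^ 2 := by
      rw [mul_right_comm, mul_pow, mul_pow (h * phi x)]
      exact key
    have := abs_le_of_sq_le_sq this (by positivity)
    exact le_of_mul_le_mul_right (abs_le.1 this).2 hp
  · have : phi y ^ 2 ≤ (2 * phi x) ^ 2 := by
      rw [mul_pow, e1, e2]
      have c1 : 1 - y ≤ 2 * (1 - x) := by linarith
      have c2 : 1 + y ≤ 2 * (1 + x) := by linarith
      calc (1 - y) * (1 + y) ≤ (2 * (1 - x)) * (2 * (1 + x)) :=
            mul_le_mul c1 c2 (by linarith) (by linarith)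
        _ = _ := by ring
    exact (abs_le.1 (abs_le_of_sq_le_sq this (by positivity))).2

/-! ### Change of variables and averaging over the step -/

lemma lintegral_comp_le_of_deriv {D S : Set ℝ} (hD : MeasurableSet D)
    {ψ ψ' : ℝ → ℝ}
    (hψ : ∀ x ∈ D, HasDerivWithinAt ψ (ψ' x) D x) (hinj : InjOn ψ D) (hmaps : MapsTo ψ D S)
    {m : ℝ} (hm : 0 < m) (hψ' : ∀ x ∈ D, m ≤ |ψ' x|) (F : ℝ → ℝ≥0∞) :
    ∫⁻ x in D, F (ψ x) ≤ ENNReal.ofReal m⁻¹ * ∫⁻ y in S, F y := by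
  have h1 : ∫⁻ x in D, F (ψ x) ≤
      ENNReal.ofReal m⁻¹ * ∫⁻ x in D, ENNReal.ofReal |ψ' x| * F (ψ x) := by
    rw [← lintegral_const_mul' _ _ ENNReal.ofReal_ne_top]
    refine setLIntegral_mono' hD fun x hx => ?_
    rw [← mul_assoc, ← ENNReal.ofReal_mul (inv_pos.2 hm).le]
    have : 1 ≤ m⁻¹ * |ψ' x| := by
      rw [inv_mul_eq_div, le_div_iff₀ hm, one_mul]; exact hψ' x hx
    calc F (ψ x) = 1 * F (ψ x) := (one_mul _).symm
      _ ≤ _ := by gcongr; exact ENNReal.one_le_ofReal.2 this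
  refine h1.trans ?_
  rw [← lintegral_image_eq_lintegral_abs_deriv_mul hD hψ hinj F]
  gcongr
  exact hmaps.image_subset

lemma lintegral_comp_shift_le {k : ℕ} {h A : ℝ} (hh : 0 ≤ h) (hA : |A| ≤ k / 2) (b : ℝ)
    (F : ℝ → ℝ≥0∞) :
    ∫⁻ x in dom k h, F (x + A * (h * phi x) + b) ≤ 2 * ∫⁻ y, F y := by
  have hder : ∀ x ∈ dom k h, HasDerivAt (fun x => x + A * (h * phi x) + b)
      (1 + A * (h * (-x / phi x))) x := fun x hx =>
    ((hasDerivAt_id x).add (((hasDerivAt_phi hx.1).const_mul h).const_mul A)).add_const b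
  have hmono : StrictMonoOn (fun x => x + A * (h * phi x) + b) (dom k h) := by
    refine strictMonoOn_of_hasDerivWithinAt_pos (convex_dom k h)
      (fun x hx => (hder x hx).continuousAt.continuousWithinAt)
      (fun x hx => (hder x (interior_subset hx)).hasDerivWithinAt) (fun x hx => ?_)
    linarith [half_le_deriv_shift hh (interior_subset hx) hA]
  have := lintegral_comp_le_of_deriv (measurableSet_dom k h)
    (fun x hx => (hder x hx).hasDerivWithinAt) hmono.injOn (mapsTo_univ _ _)
    (m := 1 / 2) (by norm_num)
    (fun x hx => (half_le_deriv_shift hh hx hA).trans (le_abs_self _)) F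
  simpa using this

/-- Pairs `(x, v)` for which the interval with centre `x + A h φ(x) + B v` and `n` steps `v` lies
in the interval with centre `x` and `n + 1` steps `h φ(x)`, and `v` is at most half a step. -/
def subPairs (n : ℕ) (h A B : ℝ) : Set (ℝ × ℝ) :=
  {z | 0 < z.2 ∧ z.2 ≤ h * phi z.1 / 2 ∧
    |z.1 + A * (h * phi z.1) + B * z.2 - z.1| + n * z.2 / 2 ≤ (n + 1 : ℕ) * (h * phi z.1) / 2}

lemma measurableSet_subPairs (n : ℕ) (h A B : ℝ) : MeasurableSet (subPairs n h A B) := by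
  have h1 : Measurable fun z : ℝ × ℝ => phi z.1 := measurable_phi.comp measurable_fst
  have h2 : Measurable fun z : ℝ × ℝ => |z.1 + A * (h * phi z.1) + B * z.2 - z.1| :=
    continuous_abs.measurable.comp (by fun_prop)
  have h3 : Measurable fun z : ℝ × ℝ => h * phi z.1 / 2 := by fun_prop
  have h4 : Measurable fun z : ℝ × ℝ => (n + 1 : ℕ) * (h * phi z.1) / 2 := by fun_prop
  have h5 : Measurable fun z : ℝ × ℝ => n * z.2 / 2 := by fun_prop
  exact (measurableSet_lt measurable_const measurable_snd).inter
    ((measurableSet_le measurable_snd h3).inter (measurableSet_le (h2.add h5) h4))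

/-- The value of `F` at the pair (centre, step), cut off outside `subPairs`. -/
def cutoff (n : ℕ) (h A B : ℝ) (F : ℝ → ℝ → ℝ≥0∞) (x v : ℝ) : ℝ≥0∞ :=
  (subPairs n h A B).indicator (fun z => F (z.1 + A * (h * phi z.1) + B * z.2) z.2) (x, v)

lemma measurable_cutoff (n : ℕ) (h A B : ℝ) {F : ℝ → ℝ → ℝ≥0∞}
    (hF : Measurable (Function.uncurry F)) :
    Measurable (Function.uncurry (cutoff n h A B F)) := by
  have h1 : Measurable fun z : ℝ × ℝ => phi z.1 := measurable_phi.comp measurable_fst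
  exact Measurable.indicator
    (hF.comp (Measurable.prodMk (by fun_prop) measurable_snd)) (measurableSet_subPairs n h A B)

lemma lintegral_step_le {c : ℝ} (hc : 0 < c) (h : ℝ) (f : ℝ → ℝ≥0∞) :
    ∫⁻ v in Ioc 0 (h * c), f v ≤ ENNReal.ofReal c * ∫⁻ τ in Ioc 0 h, f (τ * c) := by
  have := lintegral_comp_le_of_deriv (D := Ioc 0 (h * c)) (S := Ioc 0 h) measurableSet_Ioc
    (ψ := fun v => v / c) (ψ' := fun _ => 1 / c)
    (fun x _ => ((hasDerivAt_id x).div_const c).hasDerivWithinAt)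
    (fun x _ y _ hxy => by simpa [hc.ne'] using (div_left_inj' hc.ne').1 hxy)
    (fun x hx => ⟨div_pos hx.1 hc, (div_le_iff₀ hc).2 hx.2⟩)
    (m := 1 / c) (by positivity) (fun _ _ => le_abs_self _) (fun τ => f (τ * c))
  simpa [div_mul_cancel₀ _ hc.ne'] using this

lemma mu_eq_restrict_Ioo : mu = volume.restrict (Ioo (-1) 1) :=
  (Measure.restrict_congr_set Ioo_ae_eq_Icc).symm

/-- The constant 4 is a product of two factors 2: one from the Jacobian of `x ↦ y`, one from
replacing `1 / φ(x)` by `2 / φ(y)`. The rest is Fubini and the substitution `v = τ φ(y)`, whose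
Jacobian cancels `1 / φ(y)`. -/
lemma lintegral_cutoff_le {n : ℕ} (hn : 1 ≤ n) {h A B : ℝ} (hh : 0 < h)
    (hA : |A| ≤ (n + 1 : ℕ) / 2) {F : ℝ → ℝ → ℝ≥0∞} (hF : Measurable (Function.uncurry F))
    {S : ℝ≥0∞} (hS : ∀ τ ∈ Ioc 0 h, ∫⁻ y, F y (τ * phi y) ∂mu ≤ S) :
    ∫⁻ x in dom (n + 1) h, (ENNReal.ofReal (h * phi x))⁻¹ * ∫⁻ v, cutoff n h A B F x v ≤
      4 * S := by
  -- `K` dominates the integrand by a function of the new centre and step alone, so that the shift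
  -- lemma applies for each fixed `v`.
  set K : ℝ → ℝ → ℝ≥0∞ := fun y v =>
    {z : ℝ × ℝ | z.1 ∈ Ioo (-1) 1 ∧ z.2 ∈ Ioc 0 (h * phi z.1)}.indicator
      (fun z => 2 * (ENNReal.ofReal (h * phi z.1))⁻¹ * F z.1 z.2) (y, v) with hKdef
  have hφ : Measurable fun z : ℝ × ℝ => phi z.1 := measurable_phi.comp measurable_fst
  have hK : Measurable (Function.uncurry K) := by
    refine Measurable.indicator (by
      refine Measurable.mul (Measurable.const_mul (Measurable.inv ?_) 2) hF
      exact ENNReal.measurable_ofReal.comp (by fun_prop)) ?_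
    refine (measurable_fst measurableSet_Ioo).inter
      ((measurableSet_lt measurable_const measurable_snd).inter
        (measurableSet_le measurable_snd (by fun_prop)))
  have hpt : ∀ x ∈ dom (n + 1) h, ∀ v, (ENNReal.ofReal (h * phi x))⁻¹ * cutoff n h A B F x v ≤
      K (x + A * (h * phi x) + B * v) v := by
    intro x hx v
    by_cases hv : (x, v) ∈ subPairs n h A B
    · obtain ⟨hy1, hvy, hyx⟩ := step_le_of_subinterval hn hh hx hv.1 hv.2.1 hv.2.2
      simp only at hy1 hvy hyx
      set y := x + A * (h * phi x) + B * v
      have hmem : (y, v) ∈ {z : ℝ × ℝ | z.1 ∈ Ioo (-1) 1 ∧ z.2 ∈ Ioc 0 (h * phi z.1)} :=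
        ⟨abs_lt.1 hy1, hv.1, hvy⟩
      simp only [cutoff, hKdef, indicator_of_mem hv, indicator_of_mem hmem]
      gcongr
      have hpy := phi_pos hy1
      have hpx := phi_pos hx.1
      rw [← ENNReal.ofReal_inv_of_pos (by positivity), ← ENNReal.ofReal_inv_of_pos (by positivity),
        show (2 : ℝ≥0∞) = ENNReal.ofReal 2 by simp, ← ENNReal.ofReal_mul (by norm_num)]
      refine ENNReal.ofReal_le_ofReal ?_
      rw [← div_eq_mul_inv, inv_eq_one_div, div_le_div_iff₀ (by positivity) (by positivity)]
      nlinarith [mul_le_mul_of_nonneg_left hyx hh.le]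
    · simp [cutoff, indicator_of_notMem hv]
  have hKint : ∀ y ∈ Ioo (-1 : ℝ) 1, ∫⁻ v, K y v ≤
      2 * (ENNReal.ofReal h)⁻¹ * ∫⁻ τ in Ioc 0 h, F y (τ * phi y) := by
    intro y hy
    have hpy := phi_pos (abs_lt.2 hy)
    have e : ∀ v, K y v = (Ioc 0 (h * phi y)).indicator
        (fun v => 2 * (ENNReal.ofReal (h * phi y))⁻¹ * F y v) v := by
      intro v
      by_cases hv : v ∈ Ioc 0 (h * phi y)
      · rw [indicator_of_mem hv]
        exact indicator_of_mem (s := {z : ℝ × ℝ | z.1 ∈ Ioo (-1) 1 ∧ z.2 ∈ Ioc 0 (h * phi z.1)})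
          ⟨hy, hv⟩ _
      · rw [indicator_of_notMem hv]
        exact indicator_of_notMem (fun hc => hv hc.2) _
    simp only [e]
    rw [lintegral_indicator measurableSet_Ioc, lintegral_const_mul]
    · refine (mul_le_mul_right (lintegral_step_le hpy h (F y)) _).trans_eq ?_
      rw [ENNReal.ofReal_mul hh.le, ENNReal.mul_inv (by simp [hh]) (by simp)]
      have h1 : (ENNReal.ofReal (phi y))⁻¹ * ENNReal.ofReal (phi y) = 1 :=
        ENNReal.inv_mul_cancel (by simpa using hpy) ENNReal.ofReal_ne_top
      rw [← mul_assoc, mul_assoc 2, mul_assoc (ENNReal.ofReal h)⁻¹, h1, mul_one]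
    · exact hF.comp measurable_prodMk_left
  have hsc : Measurable fun z : ℝ × ℝ => (z.1, z.2 * phi z.1) :=
    measurable_fst.prodMk (measurable_snd.mul hφ)
  have hFm : Measurable (Function.uncurry fun y τ => F y (τ * phi y)) := hF.comp hsc
  calc ∫⁻ x in dom (n + 1) h, (ENNReal.ofReal (h * phi x))⁻¹ * ∫⁻ v, cutoff n h A B F x v
      ≤ ∫⁻ x in dom (n + 1) h, ∫⁻ v, K (x + A * (h * phi x) + B * v) v := by
        refine setLIntegral_mono' (measurableSet_dom _ _) fun x hx => ?_
        rw [← lintegral_const_mul]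
        · exact lintegral_mono fun v => hpt x hx v
        · exact (measurable_cutoff n h A B hF).comp measurable_prodMk_left
    _ = ∫⁻ v, ∫⁻ x in dom (n + 1) h, K (x + A * (h * phi x) + B * v) v := by
        refine lintegral_lintegral_swap (Measurable.aemeasurable ?_)
        exact hK.comp (Measurable.prodMk (by fun_prop) measurable_snd)
    _ ≤ ∫⁻ v, 2 * ∫⁻ y, K y v :=
        lintegral_mono fun v => lintegral_comp_shift_le hh.le hA (B * v) fun y => K y v
    _ = 2 * ∫⁻ y, ∫⁻ v, K y v := by
        rw [lintegral_const_mul]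
        · rw [lintegral_lintegral_swap hK.aemeasurable]
        · exact (hK.comp measurable_swap).lintegral_prod_right'
    _ = 2 * ∫⁻ y in Ioo (-1 : ℝ) 1, ∫⁻ v, K y v := by
        rw [← lintegral_indicator measurableSet_Ioo]
        congr 1
        refine lintegral_congr fun y => ?_
        by_cases hy : y ∈ Ioo (-1 : ℝ) 1
        · rw [indicator_of_mem hy]
        · rw [indicator_of_notMem hy]
          have : ∀ v, K y v = 0 := fun v => indicator_of_notMem (fun hc => hy hc.1) _
          simp [this]
    _ ≤ 2 * ∫⁻ y in Ioo (-1 : ℝ) 1,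
          2 * (ENNReal.ofReal h)⁻¹ * ∫⁻ τ in Ioc 0 h, F y (τ * phi y) := by
        gcongr 2 * ?_
        exact setLIntegral_mono' measurableSet_Ioo hKint
    _ = 4 * (ENNReal.ofReal h)⁻¹ *
          ∫⁻ τ in Ioc 0 h, ∫⁻ y in Ioo (-1 : ℝ) 1, F y (τ * phi y) := by
        rw [lintegral_const_mul, lintegral_lintegral_swap hFm.aemeasurable, ← mul_assoc,
          ← mul_assoc]
        · norm_num
        · exact hFm.lintegral_prod_right'
    _ ≤ 4 * (ENNReal.ofReal h)⁻¹ * ∫⁻ τ in Ioc 0 h, S := by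
        gcongr 4 * (ENNReal.ofReal h)⁻¹ * ?_
        refine setLIntegral_mono' measurableSet_Ioc fun τ hτ => ?_
        rw [← mu_eq_restrict_Ioo]
        exact hS τ hτ
    _ = 4 * S := by
        rw [setLIntegral_const, Real.volume_Ioc, sub_zero, mul_comm S, mul_assoc, ← mul_assoc _ _ S,
          ENNReal.inv_mul_cancel (by simpa using hh) ENNReal.ofReal_ne_top, one_mul]

/-- Averaging a pointwise bound over the free parameter `s`. -/
lemma lintegral_dom_le_of_forall_le {ι : Type*} (I : Finset ι) {n : ℕ} (hn : 1 ≤ n) {h : ℝ}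
    (hh : 0 < h) (A B c : ι → ℝ) (d : ι → ℝ → ℝ) (hA : ∀ q ∈ I, |A q| ≤ (n + 1 : ℕ) / 2)
    (hc : ∀ q ∈ I, 1 ≤ (n + 1 : ℕ) * |c q|)
    {F : ℝ → ℝ → ℝ≥0∞} (hF : Measurable (Function.uncurry F)) {S : ℝ≥0∞}
    (hS : ∀ τ ∈ Ioc 0 h, ∫⁻ y, F y (τ * phi y) ∂mu ≤ S) (H : ℝ → ℝ≥0∞)
    (hH : ∀ x ∈ dom (n + 1) h, ∀ s ∈ Ioo 0 (h * phi x / 2),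
      H x ≤ ∑ q ∈ I, cutoff n h (A q) (B q) F x (d q x + c q * s)) :
    ∫⁻ x in dom (n + 1) h, H x ≤ 8 * (n + 1 : ℕ) * I.card * S := by
  have hm := fun q => measurable_cutoff n h (A q) (B q) hF
  have hmx : ∀ q x, Measurable fun v => cutoff n h (A q) (B q) F x v := fun q x =>
    (hm q).comp measurable_prodMk_left
  have hk : (0 : ℝ) < (n + 1 : ℕ) := by positivity
  have haff : ∀ q ∈ I, ∀ (b r : ℝ) (f : ℝ → ℝ≥0∞), ∫⁻ s in Ioo 0 r, f (b + c q * s) ≤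
      (n + 1 : ℕ) * ∫⁻ v, f v := by
    intro q hq b r f
    have hcq : 0 < |c q| := by
      by_contra hcon
      have : |c q| = 0 := le_antisymm (not_lt.1 hcon) (abs_nonneg _)
      have h1 := hc q hq
      rw [this, mul_zero] at h1
      linarith
    have := lintegral_comp_le_of_deriv (D := Ioo 0 r) (S := univ) measurableSet_Ioo
      (ψ := fun s => b + c q * s) (ψ' := fun _ => c q)
      (fun x _ => by
        simpa using (((hasDerivAt_id x).const_mul (c q)).const_add b).hasDerivWithinAt)
      (fun x _ y _ hxy => mul_left_cancel₀ (abs_pos.1 hcq) (add_left_cancel hxy))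
      (mapsTo_univ _ _) (m := ((n + 1 : ℕ) : ℝ)⁻¹) (by positivity)
      (fun _ _ => by rw [inv_le_iff_one_le_mul₀' hk]; exact hc q hq) f
    rwa [inv_inv, ENNReal.ofReal_natCast, Measure.restrict_univ] at this
  have hpt : ∀ x ∈ dom (n + 1) h, H x ≤ 2 * (n + 1 : ℕ) * ∑ q ∈ I,
      (ENNReal.ofReal (h * phi x))⁻¹ * ∫⁻ v, cutoff n h (A q) (B q) F x v := by
    intro x hx
    have hpx := phi_pos hx.1
    have hδ : 0 < h * phi x := by positivity
    -- `H x` does not depend on `s`, so integrating its bound multiplies it by the length `h φ(x) /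
    -- 2`; passing from `s` to `v` costs `n + 1`, as the slopes are at least `1 / (n + 1)` in
    -- absolute value.
    have h1 : H x * ENNReal.ofReal (h * phi x / 2) ≤
        ∑ q ∈ I, (n + 1 : ℕ) * ∫⁻ v, cutoff n h (A q) (B q) F x v := by
      calc H x * ENNReal.ofReal (h * phi x / 2)
          = ∫⁻ s in Ioo 0 (h * phi x / 2), H x := by
            rw [setLIntegral_const, Real.volume_Ioo, sub_zero]
        _ ≤ ∫⁻ s in Ioo 0 (h * phi x / 2),
              ∑ q ∈ I, cutoff n h (A q) (B q) F x (d q x + c q * s) :=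
            setLIntegral_mono' measurableSet_Ioo (hH x hx)
        _ = ∑ q ∈ I, ∫⁻ s in Ioo 0 (h * phi x / 2),
              cutoff n h (A q) (B q) F x (d q x + c q * s) :=
            lintegral_finsetSum _ fun q _ => (hmx q x).comp (by fun_prop)
        _ ≤ _ := Finset.sum_le_sum fun q hq => haff q hq _ _ _
    rw [← Finset.mul_sum] at h1 ⊢
    have hne : ENNReal.ofReal (h * phi x / 2) ≠ 0 := by simpa using by positivity
    rw [← ENNReal.le_div_iff_mul_le (Or.inl hne) (Or.inl ENNReal.ofReal_ne_top)] at h1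
    refine h1.trans_eq ?_
    rw [ENNReal.div_eq_inv_mul, ENNReal.ofReal_div_of_pos two_pos,
      ENNReal.inv_div (by simp) (by simp), ENNReal.ofReal_ofNat, ENNReal.div_eq_inv_mul]
    ring
  calc ∫⁻ x in dom (n + 1) h, H x
      ≤ ∫⁻ x in dom (n + 1) h, 2 * (n + 1 : ℕ) * ∑ q ∈ I,
          (ENNReal.ofReal (h * phi x))⁻¹ * ∫⁻ v, cutoff n h (A q) (B q) F x v :=
        setLIntegral_mono' (measurableSet_dom _ _) hpt
    _ = 2 * (n + 1 : ℕ) * ∑ q ∈ I, ∫⁻ x in dom (n + 1) h,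
          (ENNReal.ofReal (h * phi x))⁻¹ * ∫⁻ v, cutoff n h (A q) (B q) F x v := by
        have hms : ∀ q ∈ I, Measurable fun x =>
            (ENNReal.ofReal (h * phi x))⁻¹ * ∫⁻ v, cutoff n h (A q) (B q) F x v := fun q _ =>
          (ENNReal.measurable_ofReal.comp (measurable_phi.const_mul h)).inv.mul
            (hm q).lintegral_prod_right'
        rw [lintegral_const_mul _ (Finset.measurable_sum I hms), lintegral_finsetSum _ hms]
    _ ≤ 2 * (n + 1 : ℕ) * ∑ q ∈ I, 4 * S := by
        gcongr with q hq
        exact lintegral_cutoff_le hn hh (hA q hq) hF hS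
    _ = _ := by
        rw [Finset.sum_const, nsmul_eq_mul]
        ring

/-! ### Weighted differences and their labelled subdivisions -/

lemma symmetricDiff_of_mem {k : ℕ} {u x : ℝ} {J : Set ℝ} (f : ℝ → ℝ)
    (hJ : x - k * u / 2 ∈ J ∧ x + k * u / 2 ∈ J) :
    symmetricDiff k u f x J = (fwdDiff u)^[k] f (x - k * u / 2) := by
  rw [symmetricDiff, if_pos hJ, fwdDiff_iter_eq_sum]
  refine Finset.sum_congr rfl fun i _ => ?_
  rw [show x + ((i : ℝ) - k / 2) * u = x - k * u / 2 + i * u by ring]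
  ring

lemma symmetricDiff_zero_step {k : ℕ} (hk : 1 ≤ k) (f : ℝ → ℝ) (x : ℝ) (J : Set ℝ) :
    symmetricDiff k 0 f x J = 0 := by
  by_cases hJ : x - k * (0 : ℝ) / 2 ∈ J ∧ x + k * (0 : ℝ) / 2 ∈ J
  · rw [symmetricDiff_of_mem f hJ]
    obtain ⟨m, rfl⟩ : ∃ m, k = m + 1 := ⟨k - 1, by omega⟩
    rw [Function.iterate_succ_apply']
    simp [fwdDiff]
  · rw [symmetricDiff, if_neg hJ]

/-- The weighted symmetric difference with centre `y` and `n` steps `v`. -/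
def weightedDiff (n r : ℕ) (g : ℝ → ℝ) (y v : ℝ) : ℝ :=
  Real.sqrt ((1 - (y + n * v / 2)) * (1 + (y - n * v / 2))) ^ r *
    symmetricDiff n v g y (Icc (-1) 1)

lemma wt_mul_symmetricDiff (n r : ℕ) (g : ℝ → ℝ) (h x : ℝ) :
    wt (n * h) x ^ r * symmetricDiff n (h * phi x) g x (Icc (-1) 1) =
      weightedDiff n r g x (h * phi x) := by
  rw [weightedDiff, wt, show 1 - x - n * h * phi x / 2 = 1 - (x + n * (h * phi x) / 2) by ring,
    show 1 + x - n * h * phi x / 2 = 1 + (x - n * (h * phi x) / 2) by ring]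

lemma weightedDiff_eq_zero_of_notMem_dom {k r : ℕ} {g : ℝ → ℝ} {h x : ℝ} (hh : 0 ≤ h)
    (hx : |x| < 1) (hxd : x ∉ dom k h) : weightedDiff k r g x (h * phi x) = 0 := by
  rw [weightedDiff, symmetricDiff, if_neg ((dom_iff_nodes hh hx).not.1 hxd), mul_zero]

lemma measurable_weightedDiff (n r : ℕ) {g : ℝ → ℝ} (hg : Measurable g) :
    Measurable (Function.uncurry (weightedDiff n r g)) := by
  have h1 : Measurable fun z : ℝ × ℝ => z.1 - n * z.2 / 2 := by fun_prop
  have h2 : Measurable fun z : ℝ × ℝ => z.1 + n * z.2 / 2 := by fun_prop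
  refine Measurable.mul (Measurable.pow_const (Real.continuous_sqrt.measurable.comp
    ((h2.const_sub 1).mul (h1.const_add 1))) r) ?_
  refine Measurable.ite ((h1 measurableSet_Icc).inter (h2 measurableSet_Icc)) ?_ measurable_const
  refine Finset.measurable_sum _ fun i _ => Measurable.const_mul (hg.comp ?_) _
  fun_prop

/-- The weight is a power of the square root of (distance from the right node to `1`) times
(distance from the left node to `-1`). Both distances grow when the interval shrinks, so an
unweighted bound passes to the weighted one with the same constant. -/
lemma abs_weightedDiff_le {n k r : ℕ} {g : ℝ → ℝ} {x u y v N : ℝ} (hv : 0 ≤ v)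
    (hmem : x - k * u / 2 ∈ Icc (-1 : ℝ) 1 ∧ x + k * u / 2 ∈ Icc (-1 : ℝ) 1)
    (hsub : |y - x| + n * v / 2 ≤ k * u / 2)
    (hle : |(fwdDiff u)^[k] g (x - k * u / 2)| ≤ N * |(fwdDiff v)^[n] g (y - n * v / 2)|) :
    |weightedDiff k r g x u| ≤ N * |weightedDiff n r g y v| := by
  have b1 := le_abs_self (y - x)
  have b2 := neg_abs_le (y - x)
  have hnv : 0 ≤ n * v / 2 := by positivity
  have hm := hmem
  obtain ⟨⟨m1, m2⟩, m3, m4⟩ := hm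
  have hmem' : y - n * v / 2 ∈ Icc (-1 : ℝ) 1 ∧ y + n * v / 2 ∈ Icc (-1 : ℝ) 1 := by
    refine ⟨⟨?_, ?_⟩, ?_, ?_⟩ <;> linarith
  rw [weightedDiff, weightedDiff, symmetricDiff_of_mem g hmem,
    symmetricDiff_of_mem g hmem', abs_mul, abs_mul, abs_pow, abs_pow,
    abs_of_nonneg (Real.sqrt_nonneg _), abs_of_nonneg (Real.sqrt_nonneg _), mul_left_comm]
  refine mul_le_mul (pow_le_pow_left₀ (Real.sqrt_nonneg _) (Real.sqrt_le_sqrt ?_) r) hle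
    (abs_nonneg _) (by positivity)
  exact mul_le_mul (by linarith) (by linarith) (by linarith) (by linarith)

/-- Labels of the differences of order `n` used to estimate one of order `n + 1`. -/
def labels (n : ℕ) : Finset (ℕ × ℕ × ℕ) :=
  Finset.range (n + 2) ×ˢ Finset.range (n + 1) ×ˢ Finset.range 3

/-- Shift of the centre in multiples of the original step. -/
def labelA (n : ℕ) (q : ℕ × ℕ × ℕ) : ℝ :=
  if q.2.2 = 2 then (q.1 + q.2.1 - (n + 1)) / 2 else q.1 / 2

/-- Shift of the centre in multiples of the new step. -/
def labelB (n : ℕ) (q : ℕ × ℕ × ℕ) : ℝ :=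
  if q.2.2 = 2 then n / 2 else q.2.2 + n / 2 - (n + 1)

/-- Slope of the new step as a function of the free parameter. -/
def labelSlope (n : ℕ) (q : ℕ × ℕ × ℕ) : ℝ :=
  if q.2.2 = 2 then 1 - q.2.1 / (n + 1) else -((q.2.1 + 1) / (n + 1))

/-- The new step at parameter zero. -/
def labelStep (h : ℝ) (q : ℕ × ℕ × ℕ) (x : ℝ) : ℝ :=
  if q.2.2 = 2 then 0 else h * phi x / 2

lemma abs_labelA_le {n : ℕ} {q : ℕ × ℕ × ℕ} (hq : q ∈ labels n) :
    |labelA n q| ≤ (n + 1 : ℕ) / 2 := by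
  obtain ⟨l, i, e⟩ := q
  simp only [labels, Finset.mem_product, Finset.mem_range] at hq
  obtain ⟨h1, h2, -⟩ := hq
  have h1' : (l : ℝ) ≤ n + 1 := by exact_mod_cast Nat.lt_succ_iff.1 h1
  have h2' : (i : ℝ) ≤ n := by exact_mod_cast Nat.lt_succ_iff.1 h2
  have h3 : (0 : ℝ) ≤ l := by positivity
  have h4 : (0 : ℝ) ≤ i := by positivity
  push_cast
  rw [abs_le, labelA]
  split_ifs <;> constructor <;> simp only <;> linarith

lemma one_le_labelSlope {n : ℕ} {q : ℕ × ℕ × ℕ} (hq : q ∈ labels n) :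
    1 ≤ (n + 1 : ℕ) * |labelSlope n q| := by
  obtain ⟨l, i, e⟩ := q
  simp only [labels, Finset.mem_product, Finset.mem_range] at hq
  obtain ⟨h1, h2, -⟩ := hq
  have h2' : (i : ℝ) ≤ n := by exact_mod_cast Nat.lt_succ_iff.1 h2
  have h4 : (0 : ℝ) ≤ i := by positivity
  have hk : (0 : ℝ) < n + 1 := by positivity
  push_cast
  rw [labelSlope]
  split_ifs
  · have : (n + 1 : ℝ) * (1 - i / (n + 1)) = n + 1 - i := by field_simp
    refine le_trans ?_ (mul_le_mul_of_nonneg_left (le_abs_self _) hk.le)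
    simp only [this]
    linarith
  · rw [abs_neg]
    refine le_trans ?_ (mul_le_mul_of_nonneg_left (le_abs_self _) hk.le)
    rw [mul_div_cancel₀ _ hk.ne']
    simp only
    linarith

/-- In a label `(l, i, e)`, `l` records the shift from step halving. The values `e = 0, 1` give the
fan rays `j = i + 1` after lowering the order, and `e = 2` the differences across the rays. The
parameter `s` is eliminated from the centre in favour of `v`, which keeps the coefficient of `h
φ(x)` within the range allowed by the shift lemma. -/
lemma exists_label {n : ℕ} (hn : 1 ≤ n) (r : ℕ) (g : ℝ → ℝ) {h x s : ℝ} (hh : 0 < h)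
    (hx : x ∈ dom (n + 1) h) (hs : s ∈ Ioo 0 (h * phi x / 2)) :
    ∃ q ∈ labels n,
      (x, labelStep h q x + labelSlope n q * s) ∈ subPairs n h (labelA n q) (labelB n q) ∧
      |weightedDiff (n + 1) r g x (h * phi x)| ≤ 4 ^ (n + 2) *
        |weightedDiff n r g (x + labelA n q * (h * phi x) +
            labelB n q * (labelStep h q x + labelSlope n q * s))
          (labelStep h q x + labelSlope n q * s)| := by
  have hmem := (dom_iff_nodes hh.le hx.1).1 hx
  have hδ : 0 < h * phi x := mul_pos hh (phi_pos hx.1)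
  have hk : (0 : ℝ) < n + 1 := by positivity
  obtain ⟨l, hl, H⟩ := exists_abs_fwdDiff_succ_le n hn (h * phi x / 2) s g
    (x - (n + 1 : ℕ) * (h * phi x) / 2)
  rw [mul_div_cancel₀ (h * phi x) two_ne_zero] at H
  have hl' : (l : ℝ) ≤ n + 1 := by exact_mod_cast hl
  have hl0 : (0 : ℝ) ≤ l := by positivity
  obtain ⟨hs0, hs1⟩ := hs
  set δ := h * phi x with hδdef
  rcases H with ⟨j, hj1, hjn, e, he, H⟩ | ⟨i, hi, H⟩
  · have he' : (e : ℝ) ≤ 1 := by exact_mod_cast he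
    have he0 : (0 : ℝ) ≤ e := by positivity
    obtain ⟨i, rfl⟩ : ∃ i, j = i + 1 := ⟨j - 1, by omega⟩
    have hin : (i : ℝ) + 1 ≤ n := by exact_mod_cast hjn
    have hi0 : (0 : ℝ) ≤ i := by positivity
    have hne : e ≠ 2 := by omega
    refine ⟨(l, i, e), by simp [labels]; omega, ?_⟩
    simp only [labelStep, labelSlope, labelA, labelB, if_neg hne, ← hδdef]
    push_cast at H
    obtain ⟨v, hv⟩ : ∃ v, v = δ / 2 + -((i + 1) / (n + 1)) * s := ⟨_, rfl⟩
    have hv' : δ / 2 - (i + 1) * s / (n + 1) = v := by rw [hv]; ring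
    -- This relation trades `s` for `v` and produces the term `-(n + 1)` in `labelB`.
    have hjs : (i + 1) * s = (n + 1) * (δ / 2 - v) := by rw [hv]; field_simp; ring
    rw [hv'] at H
    rw [← hv]
    have hv0 : 0 < v := by
      have : (n + 1) * v = (n + 1) * (δ / 2) - (i + 1) * s := by rw [hjs]; ring
      have h1 : 0 < (n + 1) * v := by
        rw [this]
        nlinarith [mul_le_mul_of_nonneg_right hin hs0.le]
      exact pos_of_mul_pos_right h1 hk.le
    have hjs0 : 0 ≤ (n + 1) * (δ / 2 - v) := by rw [← hjs]; positivity
    have hvδ : v ≤ δ / 2 := by linarith [nonneg_of_mul_nonneg_right hjs0 hk]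
    have hlδ : l * (δ / 2) ≤ (n + 1) * (δ / 2) := mul_le_mul_of_nonneg_right hl' (by linarith)
    have hlδ0 : 0 ≤ l * (δ / 2) := by positivity
    have hev : e * v ≤ v := by nlinarith
    have hev0 : 0 ≤ e * v := by positivity
    have hsub : |x + l / 2 * δ + (e + n / 2 - (n + 1)) * v - x| + n * v / 2 ≤
        (n + 1 : ℕ) * δ / 2 := by
      rw [← le_sub_iff_add_le, abs_le]
      push_cast
      constructor <;> nlinarith
    refine ⟨⟨hv0, hvδ, hsub⟩, abs_weightedDiff_le hv0.le hmem hsub ?_⟩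
    rw [show x + l / 2 * δ + (e + n / 2 - (n + 1)) * v - n * v / 2 =
      x - (n + 1) * δ / 2 + l * (δ / 2) + (i + 1) * s + e * v by rw [hjs]; ring]
    push_cast
    exact H
  · have hin : (i : ℝ) ≤ n := by exact_mod_cast hi
    have hi0 : (0 : ℝ) ≤ i := by positivity
    refine ⟨(l, i, 2), by simp [labels]; omega, ?_⟩
    simp only [labelStep, labelSlope, labelA, labelB, if_pos, ← hδdef]
    push_cast at H
    obtain ⟨v, hv⟩ : ∃ v, v = 0 + (1 - (i : ℝ) / (n + 1)) * s := ⟨_, rfl⟩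
    have hv' : s * (1 - (i : ℝ) / (n + 1)) = v := by rw [hv]; ring
    have hkv : (n + 1) * v = (n + 1 - i) * s := by rw [hv]; field_simp; ring
    rw [hv'] at H
    rw [← hv]
    have hkv0 : 0 < (n + 1) * v := by
      rw [hkv]; exact mul_pos (by linarith) hs0
    have hv0 : 0 < v := pos_of_mul_pos_right hkv0 hk.le
    have hkvδ : (n + 1) * v ≤ (n + 1 - i) * (δ / 2) := by
      rw [hkv]; exact mul_le_mul_of_nonneg_left hs1.le (by linarith)
    have hiδ : 0 ≤ i * (δ / 2) := by positivity
    have hvδ : v ≤ δ / 2 := by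
      refine le_of_mul_le_mul_left ?_ hk
      linarith
    have hlδ : l * (δ / 2) ≤ (n + 1) * (δ / 2) := mul_le_mul_of_nonneg_right hl' (by linarith)
    have hlδ0 : 0 ≤ l * (δ / 2) := by positivity
    have hsub : |x + (l + i - (n + 1)) / 2 * δ + n / 2 * v - x| + n * v / 2 ≤
        (n + 1 : ℕ) * δ / 2 := by
      rw [← le_sub_iff_add_le, abs_le]
      push_cast
      constructor <;> nlinarith
    refine ⟨⟨hv0, hvδ, hsub⟩, abs_weightedDiff_le hv0.le hmem hsub ?_⟩
    rw [show x + (l + i - (n + 1)) / 2 * δ + n / 2 * v - n * v / 2 =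
      x - (n + 1) * δ / 2 + l * (δ / 2) + i * (δ / 2) by ring]
    push_cast
    exact H

/-- Transfer of integral bounds from differences of order `n` to order `n + 1`. -/
lemma lintegral_comp_weightedDiff_le {n : ℕ} (hn : 1 ≤ n) (r : ℕ) (g : ℝ → ℝ) {h : ℝ}
    (hh : 0 < h) {F : ℝ → ℝ → ℝ≥0∞} (hF : Measurable (Function.uncurry F)) {S : ℝ≥0∞}
    (hS : ∀ τ ∈ Ioc 0 h, ∫⁻ y, F y (τ * phi y) ∂mu ≤ S) (Φ : ℝ → ℝ≥0∞) (hΦ : Φ 0 = 0)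
    (hΦF : ∀ z y v, |z| ≤ 4 ^ (n + 2) * |weightedDiff n r g y v| → Φ z ≤ F y v) :
    ∫⁻ x, Φ (weightedDiff (n + 1) r g x (h * phi x)) ∂mu ≤
      8 * (n + 1 : ℕ) * (labels n).card * S := by
  have h1 := lintegral_dom_le_of_forall_le (labels n) hn hh (labelA n) (labelB n) (labelSlope n)
    (labelStep h) (fun _ => abs_labelA_le) (fun _ => one_le_labelSlope) hF hS
    (fun x => Φ (weightedDiff (n + 1) r g x (h * phi x))) (by
      intro x hx s hs
      obtain ⟨q, hq, hq1, hq2⟩ := exists_label hn r g hh hx hs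
      refine le_trans ?_ (Finset.single_le_sum (fun _ _ => zero_le) hq)
      rw [cutoff, indicator_of_mem hq1]
      exact hΦF _ _ _ hq2)
  refine le_trans ?_ h1
  rw [mu_eq_restrict_Ioo, ← lintegral_indicator (measurableSet_dom _ _)]
  refine le_trans (setLIntegral_mono' measurableSet_Ioo fun x hx => ?_)
    (setLIntegral_le_lintegral (Ioo (-1) 1) _)
  by_cases hxd : x ∈ dom (n + 1) h
  · rw [indicator_of_mem hxd]
  · rw [weightedDiff_eq_zero_of_notMem_dom hh.le (abs_lt.2 hx) hxd, hΦ]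
    exact zero_le

/-! ### Comparison of norms and moduli -/

/-- The constant in the comparison of the moduli. -/
def compConst (n : ℕ) : ℝ≥0 := 8 * (n + 1 : ℕ) * (labels n).card * 4 ^ (n + 2)

lemma one_le_mul_card_labels (n : ℕ) :
    (1 : ℝ≥0) ≤ 8 * (n + 1 : ℕ) * (labels n).card := by
  have : 0 < (labels n).card := by simp [labels]
  exact_mod_cast Nat.succ_le_of_lt (show 0 < 8 * (n + 1) * (labels n).card by positivity)

lemma enorm_le_four_pow_mul {m : ℕ} {z w : ℝ} (h : |z| ≤ 4 ^ m * |w|) :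
    ‖z‖ₑ ≤ 4 ^ m * ‖w‖ₑ := by
  rw [Real.enorm_eq_ofReal_abs, Real.enorm_eq_ofReal_abs]
  refine (ENNReal.ofReal_le_ofReal h).trans_eq ?_
  rw [ENNReal.ofReal_mul (by positivity), ENNReal.ofReal_pow (by norm_num)]
  simp

/-- One transfer principle serves all `p`: for finite `p` the test function is the `p`-th power, for
`p = ∞` the indicator of exceeding a level, with zero integral. -/
lemma eLpNorm_weightedDiff_succ_le {n : ℕ} (hn : 1 ≤ n) (r : ℕ) {p : ℝ≥0∞} (hp : 1 ≤ p)
    {g : ℝ → ℝ} (hg : Measurable g) {h : ℝ} (hh : 0 < h) {M : ℝ≥0∞}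
    (hM : ∀ τ ∈ Ioc 0 h, eLpNorm (fun y => weightedDiff n r g y (τ * phi y)) p mu ≤ M) :
    eLpNorm (fun x => weightedDiff (n + 1) r g x (h * phi x)) p mu ≤ compConst n * M := by
  have hW := measurable_weightedDiff n r hg
  have hW' := measurable_weightedDiff (n + 1) r hg
  have hC := one_le_mul_card_labels n
  have hCe : (compConst n : ℝ≥0∞) = 8 * (n + 1 : ℕ) * (labels n).card * 4 ^ (n + 2) := by
    simp [compConst]
  have hC1 : (1 : ℝ≥0∞) ≤ 8 * (n + 1 : ℕ) * (labels n).card := by exact_mod_cast hC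
  rw [hCe]
  set C : ℝ≥0∞ := 8 * (n + 1 : ℕ) * (labels n).card
  set N : ℝ≥0∞ := 4 ^ (n + 2)
  have hp0 : p ≠ 0 := (zero_lt_one.trans_le hp).ne'
  by_cases hpt : p = ⊤
  · subst hpt
    rw [eLpNorm_exponent_top]
    have key := lintegral_comp_weightedDiff_le hn r g hh
      -- Exceeding `M` happens only on a null set for every `τ`, hence `S = 0`; the level for order
      -- `n + 1` is larger by the pointwise constant `N`.
      (F := fun y v => if M < ‖weightedDiff n r g y v‖ₑ then 1 else 0)
      (Measurable.ite (measurableSet_lt measurable_const hW.enorm) measurable_const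
        measurable_const) (S := 0) (fun τ hτ => by
          refine (lintegral_eq_zero_of_ae_eq_zero ?_).le
          have h1 := hM τ hτ
          rw [eLpNorm_exponent_top] at h1
          filter_upwards [ae_le_eLpNormEssSup (μ := mu)
            (f := fun y => weightedDiff n r g y (τ * phi y))] with y hy
          exact if_neg (not_lt.2 (hy.trans h1)))
      (fun z => if N * M < ‖z‖ₑ then 1 else 0) (by simp) (by
        intro z y v hz
        split_ifs with h1 h2
        · exact le_rfl
        · exact absurd h1 (not_lt.2 ((enorm_le_four_pow_mul hz).trans
            (mul_le_mul_right (not_lt.1 h2) _)))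
        · exact zero_le
        · exact zero_le)
    rw [mul_zero, nonpos_iff_eq_zero, lintegral_eq_zero_iff] at key
    · have hle : eLpNormEssSup (fun x => weightedDiff (n + 1) r g x (h * phi x)) mu ≤ N * M := by
        refine essSup_le_of_ae_le _ ?_
        filter_upwards [key] with x hx
        by_contra hcon
        simp [not_le.1 hcon] at hx
      refine hle.trans ?_
      rw [mul_assoc]
      exact le_mul_of_one_le_left zero_le hC1
    · refine Measurable.ite (measurableSet_lt measurable_const ?_) measurable_const
        measurable_const
      exact (hW'.comp (measurable_id.prodMk (measurable_phi.const_mul h))).enorm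
  · have hpr : 0 < p.toReal := ENNReal.toReal_pos hp0 hpt
    have hpr1 : 1 ≤ p.toReal := by
      rw [← ENNReal.toReal_one]; exact ENNReal.toReal_mono hpt hp
    have key := lintegral_comp_weightedDiff_le hn r g hh
      (F := fun y v => (N * ‖weightedDiff n r g y v‖ₑ) ^ p.toReal)
      ((hW.enorm.const_mul N).pow_const _) (S := (N * M) ^ p.toReal) (fun τ hτ => by
          have h1 := hM τ hτ
          rw [eLpNorm_eq_lintegral_rpow_enorm_toReal hp0 hpt, one_div,
            ENNReal.rpow_inv_le_iff hpr] at h1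
          simp only [ENNReal.mul_rpow_of_nonneg _ _ hpr.le]
          rw [lintegral_const_mul' _ _ (ENNReal.rpow_ne_top_of_nonneg hpr.le
            (by simp [N]))]
          exact mul_le_mul_right h1 _)
      (fun z => ‖z‖ₑ ^ p.toReal) (by simp [hpr]) (fun z y v hz =>
        ENNReal.rpow_le_rpow (enorm_le_four_pow_mul hz) hpr.le)
    rw [eLpNorm_eq_lintegral_rpow_enorm_toReal hp0 hpt, one_div, ENNReal.rpow_inv_le_iff hpr,
      mul_assoc, ENNReal.mul_rpow_of_nonneg _ _ hpr.le]
    refine key.trans (mul_le_mul_left ?_ _)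
    -- As `C ≥ 1` and `p ≥ 1`, the `p`-th root of `C` is at most `C`, so the constant does not
    -- depend on `p`.
    calc C = C ^ (1 : ℝ) := (ENNReal.rpow_one C).symm
      _ ≤ C ^ p.toReal := ENNReal.rpow_le_rpow_of_exponent_le hC1 hpr1

lemma modulus_eq (k r : ℕ) (p : ℝ≥0∞) (g : ℝ → ℝ) (t : ℝ) :
    modulus k r p g t =
      ⨆ h ∈ Icc (0 : ℝ) t, eLpNorm (fun x => weightedDiff k r g x (h * phi x)) p mu := by
  simp only [modulus, wt_mul_symmetricDiff]

lemma modulus_succ_le_of_measurable {n : ℕ} (hn : 1 ≤ n) (r : ℕ) {p : ℝ≥0∞} (hp : 1 ≤ p)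
    {g : ℝ → ℝ} (hg : Measurable g) (t : ℝ) :
    modulus (n + 1) r p g t ≤ compConst n * modulus n r p g t := by
  rw [modulus_eq, modulus_eq]
  refine iSup₂_le fun h hh => ?_
  rcases hh.1.eq_or_lt with rfl | h0
  · simp [weightedDiff, symmetricDiff_zero_step]
  · exact eLpNorm_weightedDiff_succ_le hn r hp hg h0 fun τ hτ =>
      le_iSup₂ (f := fun h (_ : h ∈ Icc (0 : ℝ) t) =>
        eLpNorm (fun x => weightedDiff n r g x (h * phi x)) p mu) τ ⟨hτ.1.le, hτ.2.trans hh.2⟩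

/-! ### Passage to a measurable representative -/

/-- Each node is a map of slope at least `1 / 2` in `x`, so the preimage in `dom k h` of a null set
is null. This follows from `lintegral_comp_shift_le` applied to the indicator of a measurable null
set. -/
lemma weightedDiff_ae_congr (k r : ℕ) {g g' : ℝ → ℝ} (hgg : g =ᵐ[mu] g') {h : ℝ} (hh : 0 ≤ h) :
    (fun x => weightedDiff k r g x (h * phi x)) =ᵐ[mu]
      fun x => weightedDiff k r g' x (h * phi x) := by
  have hnull : volume {z | ¬ (z ∈ Icc (-1 : ℝ) 1 → g z = g' z)} = 0 :=
    (ae_restrict_iff' measurableSet_Icc).1 hgg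
  set Z := toMeasurable volume {z | ¬ (z ∈ Icc (-1 : ℝ) 1 → g z = g' z)}
  have hZ : MeasurableSet Z := measurableSet_toMeasurable _ _
  have hZ0 : volume Z = 0 := by rw [measure_toMeasurable, hnull]
  have hnode : ∀ i ∈ Finset.range (k + 1), ∀ᵐ x ∂(volume.restrict (dom k h)),
      x + ((i : ℝ) - k / 2) * (h * phi x) + 0 ∉ Z := by
    intro i hi
    have hi' : (i : ℝ) ≤ k := by exact_mod_cast Nat.lt_succ_iff.1 (Finset.mem_range.1 hi)
    have hi0 : (0 : ℝ) ≤ i := by positivity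
    have h1 := lintegral_comp_shift_le (k := k) hh (A := (i : ℝ) - k / 2)
      (abs_le.2 ⟨by linarith, by linarith⟩) 0 (Z.indicator 1)
    rw [lintegral_indicator_one hZ, hZ0, mul_zero, nonpos_iff_eq_zero, lintegral_eq_zero_iff] at h1
    · filter_upwards [h1] with x hx hxZ
      rw [indicator_of_mem hxZ] at hx
      exact one_ne_zero hx
    · have hm : Measurable fun x => x + ((i : ℝ) - k / 2) * (h * phi x) + 0 :=
        (measurable_id.add ((measurable_phi.const_mul h).const_mul _)).add_const 0
      exact (measurable_one.indicator hZ).comp hm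
  rw [← Finset.eventually_all, ae_restrict_iff' (measurableSet_dom k h)] at hnode
  rw [mu_eq_restrict_Ioo, Filter.EventuallyEq, ae_restrict_iff' measurableSet_Ioo]
  filter_upwards [hnode] with x hx hx1
  by_cases hxd : x ∈ dom k h
  · have hmem := (dom_iff_nodes hh (abs_lt.2 hx1)).1 hxd
    simp only [weightedDiff, symmetricDiff, if_pos hmem]
    congr 1
    refine Finset.sum_congr rfl fun i hi => ?_
    have h2 := hx hxd i hi
    rw [add_zero] at h2
    have h3 := not_not.1 fun hc => h2 (subset_toMeasurable volume _ hc)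
    have hi' : (i : ℝ) ≤ k := by exact_mod_cast Nat.lt_succ_iff.1 (Finset.mem_range.1 hi)
    have hδ : 0 ≤ h * phi x := mul_nonneg hh (phi_nonneg x)
    have hiδ := mul_le_mul_of_nonneg_right hi' hδ
    have hiδ0 : 0 ≤ i * (h * phi x) := by positivity
    obtain ⟨⟨m1, m2⟩, m3, m4⟩ := hmem
    rw [h3 ⟨by linarith, by linarith⟩]
  · rw [weightedDiff_eq_zero_of_notMem_dom hh (abs_lt.2 hx1) hxd,
      weightedDiff_eq_zero_of_notMem_dom hh (abs_lt.2 hx1) hxd]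

lemma modulus_congr_ae (k r : ℕ) (p : ℝ≥0∞) {g g' : ℝ → ℝ} (hgg : g =ᵐ[mu] g') (t : ℝ) :
    modulus k r p g t = modulus k r p g' t := by
  rw [modulus_eq, modulus_eq]
  exact iSup_congr fun h => iSup_congr fun hh => eLpNorm_congr_ae (weightedDiff_ae_congr k r hgg hh.1)

lemma exists_measurable_ae_eq_iteratedDeriv {p : ℝ≥0∞} {r : ℕ} {f : ℝ → ℝ} (hf : f ∈ B p r) :
    ∃ g, Measurable g ∧ iteratedDeriv r f =ᵐ[mu] g := by
  cases r with
  | zero =>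
    rw [iteratedDeriv_zero]
    have hf' : MemLp f p mu := hf
    obtain ⟨g, hg, hfg⟩ := hf'.aestronglyMeasurable
    exact ⟨g, hg.measurable, hfg⟩
  | succ s =>
    refine ⟨_, ?_, Filter.EventuallyEq.rfl⟩
    rw [iteratedDeriv_succ]
    exact measurable_deriv _

end DTModulus

end

theorem mainTheorem11 (k r : ℕ) (hk : 2 ≤ k) (p : ℝ≥0∞) (hp : 1 ≤ p) :
    ∃ c : ℝ≥0, ∀ f ∈ DTModulus.B p r, ∀ t : ℝ, 0 ≤ t →
      DTModulus.modulus k r p (iteratedDeriv r f) t ≤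
        (c : ℝ≥0∞) * DTModulus.modulus (k - 1) r p (iteratedDeriv r f) t := by
  obtain ⟨n, rfl⟩ : ∃ n, k = n + 1 := ⟨k - 1, by omega⟩
  refine ⟨DTModulus.compConst n, fun f hf t _ => ?_⟩
  obtain ⟨g, hg, hfg⟩ := DTModulus.exists_measurable_ae_eq_iteratedDeriv hf
  rw [Nat.add_sub_cancel, DTModulus.modulus_congr_ae _ r p hfg, DTModulus.modulus_congr_ae _ r p hfg]
  exact DTModulus.modulus_succ_le_of_measurable (by omega) r hp hg t
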